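/- **Proposition.** There exist a finite solvable group $G$ and a faithful irreducible complex character $\chi\in\operatorname{Irr}(G)$ with $\chi(1)=10$ such that $$\chi\overline{\chi}=1_G+\alpha_1+4\alpha_2,$$ where $\alpha_1,\alpha_2\in\operatorname{Irr}(G)$ are non-principal, $\alpha_1(1)=3$ and $\alpha_2(1)=24$. Moreover, $G$ can be chosen as a semidirect product $G=E\rtimes H$, where $E$ is an extra-special group of order $5^3$ and exponent $5$ and $H\cong\operatorname{SL}(2,3)$ acts faithfully on $E$, in such a way that, with $\operatorname{Ker}(\alpha)=\{g\in G : \alpha(g)=\alpha(1)\}$: * $\operatorname{Ker}(\alpha_1)$ is not abelian; * $E/\mathbf{Z}(G)$ is a chief factor of $G$ with $E\le\operatorname{Ker}(\alpha_1)$; * $G/E\cong\operatorname{SL}(2,3)$, and the Fitting subgroup of $G/E$ is isomorphic to the quaternion group $Q_8$. -/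

import Mathlib

open scoped MatrixGroups ComplexConjugate

/-- `χ ∈ Irr(G)`: the function `χ : G → ℂ` is the character of a finite-dimensional irreducible
complex representation of `G`. -/
def IsIrrChar {G : Type} [Group G] (χ : G → ℂ) : Prop :=
  ∃ (V : Type) (_ : AddCommGroup V) (_ : Module ℂ V) (_ : FiniteDimensional ℂ V)
    (ρ : Representation ℂ G V), ρ.IsIrreducible ∧ ρ.character = χ

/-- The kernel `{g | χ(g) = χ(1)}` of a character. -/
def charKer {G : Type} [Group G] (χ : G → ℂ) : Set G :=
  {g | χ g = χ 1}

/-- A character is faithful if its kernel is trivial. -/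
def IsFaithfulChar {G : Type} [Group G] (χ : G → ℂ) : Prop :=
  charKer χ = {1}

/-- `E / Z` is a chief factor of `G`: `Z < E` are normal in `G`, and no normal subgroup of `G`
lies strictly between them. -/
def IsChiefFactor {G : Type} [Group G] (E Z : Subgroup G) : Prop :=
  Z.Normal ∧ E.Normal ∧ Z < E ∧
    ∀ N : Subgroup G, N.Normal → Z ≤ N → N ≤ E → N = Z ∨ N = E

/-- The Fitting subgroup of a finite group: the subgroup generated by all the nilpotent normal
subgroups. -/
def fittingSubgroup (G : Type) [Group G] : Subgroup G :=
  sSup {N : Subgroup G | N.Normal ∧ Group.IsNilpotent N}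

/-- A finite `p`-group `E` is extra-special if its centre is equal to its commutator subgroup,
has order `p`, and has an elementary abelian quotient `E / Z(E)` (which is abelian as the centre
is the commutator subgroup). -/
def IsExtraspecial (p : ℕ) (E : Type) [Group E] : Prop :=
  Finite E ∧ IsPGroup p E ∧ Subgroup.center E = commutator E ∧
    Nat.card (Subgroup.center E) = p ∧ ∀ x : E, x ^ p ∈ Subgroup.center E

/-!
The group is `G = E ⋊ H` with `E` the Heisenberg group over `ZMod 5` and `H = SL(2,3)`, realized as
the group of the `24` Hurwitz units. Reducing the Hurwitz quaternions modulo `5`, where they split,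
embeds `H` into `SL(2,5)`, which acts on `E` through the symplectic plane `E / Z(E)` and centralizes
`Z(E)`. No nontrivial Hurwitz unit has the eigenvalue `1` modulo `5`, because its trace is not `2`
(`embedSL_trace_ne_two`). Hence `H` permutes the `24` nonzero vectors of the plane regularly
(`orbit_bijective`). This gives `Z(G) = Z(E)`, the faithful action, and the chief factor `E / Z(G)`.

The character of degree `10` is a product `χ = ω * θ`. Here `ω` is the character of degree `5` of
the Weil representation, which extends the Schrödinger representation of `E` to `G` (`weilHom`), and
`θ` is the two-dimensional representation of the Hurwitz units on `ℂ²`. Now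
* `θ * conj θ = 1 + α₁`, where `α₁` belongs to the action of the Hurwitz units by rotations on the
  pure quaternions (`charThree`);
* `ω * conj ω = 1 + α₂`, where `α₂` is induced from a nontrivial linear character of `E`
  (`charTwentyFour`): on `E` the product is `25` on the center and `0` elsewhere, and outside `E`
  it is `1`, by the evaluation of quadratic Gauss sums (`trace_weilHom_mul_conj`);
* `α₁ * α₂ = 3 * α₂`, since `α₂` vanishes outside `E` and `α₁` equals `3` on `E`.

So `χ * conj χ = (1 + α₁) * (1 + α₂) = 1 + α₁ + 4 * α₂`. The proof compares the values of both sides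
on the center of `E`, on the rest of `E` and outside `E` (`charTen_mul_conj`). The three characters
are irreducible because they have norm one (`isIrrChar_trace`, `sum_heisSL`).

The Weil representation is given by explicit kernels, and its multiplicativity is the evaluation of
quadratic Gauss sums over `ZMod 5` (`weilMatrix_mul`). The Fitting subgroup of `SL(2,3)` is the
quaternion group, as iterated commutators with an element outside it never become trivial
(`le_range_quaternionHom_of_isNilpotent`).
-/

open scoped commutatorElement

/-! ### The group `SL(2,3)` as the group of Hurwitz units -/

/-- The representative in `{-1, 0, 1}` of a residue modulo `3`. -/
def minAbsLift (t : ZMod 3) : ℤ := if t = 0 then 0 else if t = 1 then 1 else -1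

/-- Among the integer quadruples of the shape `(±2, 0, 0, 0)` (up to order) or `(±1, ±1, ±1, ±1)`,
i.e. the doubled Hurwitz units, there is exactly one that reduces to a given quadruple `v` of norm
`1` modulo `3`; this is its coordinate with residue `v i`. -/
def hurwitzLift (v : Fin 4 → ZMod 3) (i : Fin 4) : ℤ :=
  if v 0 * v 1 * v 2 * v 3 = 0 then -2 * minAbsLift (v i) else minAbsLift (v i)

/-- The coordinates with respect to `1, i, j, k` of twice the Hurwitz unit that corresponds to an
element of `SL(2,3)`, where `i ↦ !![0, 1; -1, 0]` and `j ↦ !![1, 1; 1, -1]` identifies the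
Hurwitz quaternions modulo `3` with the `2 × 2` matrices over `ZMod 3`. -/
def hurwitz (g : SL(2, ZMod 3)) : Fin 4 → ℤ :=
  hurwitzLift ![g 0 0 + g 1 1, g 0 1 - g 1 0, g 1 1 - g 0 0 - g 0 1 - g 1 0,
    g 1 1 - g 0 0 + g 0 1 + g 1 0]

theorem hurwitz_norm : ∀ g, hurwitz g 0 ^ 2 + hurwitz g 1 ^ 2 + hurwitz g 2 ^ 2 +
    hurwitz g 3 ^ 2 = 4 := by
  decide +kernel

/-- Hurwitz units multiply like quaternions; the factor `2` is due to the doubled coordinates. -/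
theorem two_mul_hurwitz_mul : ∀ g h,
    2 * hurwitz (g * h) 0 = hurwitz g 0 * hurwitz h 0 - hurwitz g 1 * hurwitz h 1
      - hurwitz g 2 * hurwitz h 2 - hurwitz g 3 * hurwitz h 3 ∧
    2 * hurwitz (g * h) 1 = hurwitz g 0 * hurwitz h 1 + hurwitz g 1 * hurwitz h 0
      + hurwitz g 2 * hurwitz h 3 - hurwitz g 3 * hurwitz h 2 ∧
    2 * hurwitz (g * h) 2 = hurwitz g 0 * hurwitz h 2 - hurwitz g 1 * hurwitz h 3
      + hurwitz g 2 * hurwitz h 0 + hurwitz g 3 * hurwitz h 1 ∧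
    2 * hurwitz (g * h) 3 = hurwitz g 0 * hurwitz h 3 + hurwitz g 1 * hurwitz h 2
      - hurwitz g 2 * hurwitz h 1 + hurwitz g 3 * hurwitz h 0 := by
  decide +kernel

theorem hurwitz_one :
    hurwitz 1 0 = 2 ∧ hurwitz 1 1 = 0 ∧ hurwitz 1 2 = 0 ∧ hurwitz 1 3 = 0 := by decide +kernel

theorem hurwitz_inv_zero : ∀ g, hurwitz g⁻¹ 0 = hurwitz g 0 := by decide +kernel

theorem hurwitz_zero_mem : ∀ g, g ≠ 1 →
    hurwitz g 0 = -2 ∨ hurwitz g 0 = -1 ∨ hurwitz g 0 = 0 ∨ hurwitz g 0 = 1 := by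
  decide +kernel

theorem sum_hurwitz_zero_sq : ∑ g, hurwitz g 0 ^ 2 = 24 := by decide +kernel

theorem sum_hurwitz_zero_sq_sub_one_sq : ∑ g, (hurwitz g 0 ^ 2 - 1) ^ 2 = 24 := by
  decide +kernel

theorem card_SL_two_three : Fintype.card SL(2, ZMod 3) = 24 := by decide +kernel

section split

variable {R : Type*} [CommRing R]

/-- The action of the Hurwitz units on the two-dimensional space `R²`, for a commutative ring `R`
in which `2` has the inverse `half` and `-1` has the square root `ι`: over such a ring the
quaternions split. -/
def splitHom (half ι : R) (hhalf : 2 * half = 1) (hι : ι * ι = -1) :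
    SL(2, ZMod 3) →* Matrix (Fin 2) (Fin 2) R where
  toFun g := half • !![(hurwitz g 0 : R) + hurwitz g 1 * ι, hurwitz g 2 + hurwitz g 3 * ι;
    -hurwitz g 2 + hurwitz g 3 * ι, hurwitz g 0 - hurwitz g 1 * ι]
  map_one' := by
    have h2 : half * 2 = 1 := by rw [mul_comm, hhalf]
    ext i j
    fin_cases i <;> fin_cases j <;> simp [hurwitz_one, h2]
  map_mul' g h := by
    obtain ⟨h0, h1, h2, h3⟩ := two_mul_hurwitz_mul g h
    -- the integers `2 * hurwitz (g * h) i` are known, and `half = 2 * half ^ 2`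
    have key : ∀ x y : ℤ, 2 * x = y → (x : R) = half * y := by
      rintro x y rfl
      push_cast
      linear_combination -(x : R) * hhalf
    rw [smul_mul_smul, Matrix.mul_fin_two]
    ext i j
    fin_cases i <;> fin_cases j <;>
      simp only [Matrix.smul_apply, Matrix.of_apply, Matrix.cons_val', Matrix.cons_val_zero,
        Matrix.cons_val_one, Matrix.cons_val_fin_one, Fin.zero_eta, Fin.mk_one, smul_eq_mul,
        key _ _ h0, key _ _ h1, key _ _ h2, key _ _ h3] <;> push_cast
    · linear_combination half ^ 2 * (-hurwitz g 1 * hurwitz h 1 - hurwitz g 3 * hurwitz h 3) * hι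
    · linear_combination half ^ 2 * (-hurwitz g 1 * hurwitz h 3 + hurwitz g 3 * hurwitz h 1) * hι
    · linear_combination half ^ 2 * (-hurwitz g 3 * hurwitz h 1 + hurwitz g 1 * hurwitz h 3) * hι
    · linear_combination half ^ 2 * (-hurwitz g 3 * hurwitz h 3 - hurwitz g 1 * hurwitz h 1) * hι

theorem splitHom_apply (half ι : R) (hhalf : 2 * half = 1) (hι : ι * ι = -1)
    (g : SL(2, ZMod 3)) : splitHom half ι hhalf hι g =
      half • !![(hurwitz g 0 : R) + hurwitz g 1 * ι, hurwitz g 2 + hurwitz g 3 * ι;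
        -hurwitz g 2 + hurwitz g 3 * ι, hurwitz g 0 - hurwitz g 1 * ι] :=
  rfl

theorem trace_splitHom (half ι : R) (hhalf : 2 * half = 1) (hι : ι * ι = -1)
    (g : SL(2, ZMod 3)) : (splitHom half ι hhalf hι g).trace = hurwitz g 0 := by
  rw [splitHom_apply, Matrix.trace_smul, Matrix.trace_fin_two_of, smul_eq_mul]
  linear_combination (hurwitz g 0 : R) * hhalf

theorem det_splitHom (half ι : R) (hhalf : 2 * half = 1) (hι : ι * ι = -1)
    (g : SL(2, ZMod 3)) : (splitHom half ι hhalf hι g).det = 1 := by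
  have hn : (hurwitz g 0 : R) ^ 2 + (hurwitz g 1 : R) ^ 2 + (hurwitz g 2 : R) ^ 2 +
    (hurwitz g 3 : R) ^ 2 = 4 := mod_cast congrArg (Int.cast : ℤ → R) (hurwitz_norm g)
  rw [splitHom_apply, Matrix.det_smul, Matrix.det_fin_two_of, Fintype.card_fin]
  linear_combination half ^ 2 * hn + (2 * half + 1) * hhalf -
    half ^ 2 * ((hurwitz g 1 : R) ^ 2 + (hurwitz g 3 : R) ^ 2) * hι

end split

/-- The embedding of `SL(2,3)` into `SL(2,5)` given by the Hurwitz units, with `i ↦ 2` as square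
root of `-1`. -/
def embedSL : SL(2, ZMod 3) →* SL(2, ZMod 5) where
  toFun g := ⟨splitHom 3 2 (by decide) (by decide) g, det_splitHom _ _ _ _ g⟩
  map_one' := Subtype.ext (map_one _)
  map_mul' g h := Subtype.ext (map_mul _ g h)

/-- Nontrivial elements of the image of `SL(2,3)` in `SL(2,5)` do not have the eigenvalue `1`. -/
theorem embedSL_trace_ne_two {g : SL(2, ZMod 3)} (hg : g ≠ 1) :
    embedSL g 0 0 + embedSL g 1 1 ≠ 2 := by
  have h : embedSL g 0 0 + embedSL g 1 1 = (hurwitz g 0 : ZMod 5) := by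
    rw [← trace_splitHom (R := ZMod 5) 3 2 (by decide) (by decide) g, Matrix.trace_fin_two]
    rfl
  rw [h]
  rcases hurwitz_zero_mem g hg with h | h | h | h <;> rw [h] <;> decide

/-- The rotations of three-dimensional space induced by the Hurwitz units acting by conjugation
on the pure quaternions. -/
noncomputable def rotationHom : SL(2, ZMod 3) →* Matrix (Fin 3) (Fin 3) ℂ :=
  let rot (a b c d : ℂ) : Matrix (Fin 3) (Fin 3) ℂ :=
    (1 / 4 : ℂ) • !![a ^ 2 + b ^ 2 - c ^ 2 - d ^ 2, 2 * (b * c - a * d), 2 * (b * d + a * c);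
      2 * (b * c + a * d), a ^ 2 - b ^ 2 + c ^ 2 - d ^ 2, 2 * (c * d - a * b);
      2 * (b * d - a * c), 2 * (c * d + a * b), a ^ 2 - b ^ 2 - c ^ 2 + d ^ 2]
  { toFun g := rot (hurwitz g 0) (hurwitz g 1) (hurwitz g 2) (hurwitz g 3)
    map_one' := by
      ext i j
      fin_cases i <;> fin_cases j <;> norm_num [rot, hurwitz_one]
    map_mul' g h := by
      obtain ⟨h0, h1, h2, h3⟩ := two_mul_hurwitz_mul g h
      have key : ∀ x y : ℤ, 2 * x = y → (x : ℂ) = 1 / 2 * y := by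
        rintro x y rfl
        push_cast
        ring
      simp only [key _ _ h0, key _ _ h1, key _ _ h2, key _ _ h3, rot, smul_mul_smul]
      ext i j
      fin_cases i <;> fin_cases j <;>
        simp <;> ring }

theorem trace_rotationHom (g : SL(2, ZMod 3)) :
    (rotationHom g).trace = (hurwitz g 0 : ℂ) ^ 2 - 1 := by
  have hn : (hurwitz g 0 : ℂ) ^ 2 + (hurwitz g 1 : ℂ) ^ 2 + (hurwitz g 2 : ℂ) ^ 2 +
    (hurwitz g 3 : ℂ) ^ 2 = 4 := mod_cast congrArg (Int.cast : ℤ → ℂ) (hurwitz_norm g)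
  simp only [rotationHom, MonoidHom.coe_mk, OneHom.coe_mk, Matrix.trace,
    Matrix.diag, Fin.sum_univ_three]
  simp
  linear_combination -1 / 4 * hn

/-! ### The Fitting subgroup of `SL(2,3)` -/

/-- The quaternion group inside `SL(2,3)`, with `a ↦ i` and `x ↦ j` for the matrices `i, j` used in
`hurwitz`. -/
def quaternionHom : QuaternionGroup 2 →* SL(2, ZMod 3) where
  toFun
    | .a i => ⟨!![0, 1; -1, 0], by decide⟩ ^ i.val
    | .xa i => ⟨!![1, 1; 1, -1], by decide⟩ * ⟨!![0, 1; -1, 0], by decide⟩ ^ i.val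
  map_one' := by decide +kernel
  map_mul' := by decide +kernel

theorem quaternionHom_injective : Function.Injective quaternionHom :=
  (injective_iff_map_eq_one _).2 (by decide +kernel)

theorem mem_range_quaternionHom (g : SL(2, ZMod 3)) : g ∈ quaternionHom.range ↔ g ^ 4 = 1 := by
  have h : ∀ g : SL(2, ZMod 3), (∃ q, quaternionHom q = g) ↔ g ^ 4 = 1 := by decide +kernel
  exact h g

theorem isPGroup_quaternionGroup_two : IsPGroup 2 (QuaternionGroup 2) :=
  IsPGroup.of_card (n := 3) (by rw [Nat.card_eq_fintype_card, QuaternionGroup.card]; rfl)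

instance normal_range_quaternionHom : quaternionHom.range.Normal where
  conj_mem x hx g := by
    rw [mem_range_quaternionHom] at hx ⊢
    rw [conj_pow, hx, mul_one, mul_inv_cancel]

/-- The commutators `⁅x, g⁆` and, iterating, `⁅⁅x, g⁆, x⁆, ⁅⁅⁅x, g⁆, x⁆, x⁆, …` with `x` outside the
quaternion group never die out, so a nilpotent normal subgroup contains no such `x`. -/
theorem le_range_quaternionHom_of_isNilpotent (N : Subgroup SL(2, ZMod 3)) [N.Normal]
    (hN : Group.IsNilpotent N) : N ≤ quaternionHom.range := by
  have h₁ : ∀ x : SL(2, ZMod 3), x ^ 4 ≠ 1 → ∃ g : SL(2, ZMod 3),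
      ⁅x, g⁆ ^ 4 = 1 ∧ ⁅x, g⁆ ^ 2 ≠ 1 := by
    decide +kernel
  have h₂ : ∀ x : SL(2, ZMod 3), x ^ 4 ≠ 1 → ∀ y : SL(2, ZMod 3), y ^ 4 = 1 → y ^ 2 ≠ 1 →
      ⁅y, x⁆ ^ 4 = 1 ∧ ⁅y, x⁆ ^ 2 ≠ 1 := by
    decide +kernel
  intro x hx
  rw [mem_range_quaternionHom]
  by_contra hx4
  have key (n : ℕ) : ∃ y ∈ N.lowerCentralSeries n, y ^ 4 = 1 ∧ y ^ 2 ≠ 1 := by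
    induction n with
    | zero =>
      obtain ⟨g, hg⟩ := h₁ x hx4
      refine ⟨⁅x, g⁆, ?_, hg⟩
      rw [commutatorElement_def, mul_assoc, mul_assoc]
      exact N.mul_mem hx (by simpa [mul_assoc] using ‹N.Normal›.conj_mem _ (N.inv_mem hx) g)
    | succ n ih =>
      obtain ⟨y, hy, hy4, hy2⟩ := ih
      exact ⟨⁅y, x⁆, Subgroup.commutator_mem_commutator hy hx, h₂ x hx4 y hy4 hy2⟩
  obtain ⟨n, hn⟩ := Subgroup.isNilpotent_iff_lowerCentralSeries N |>.1 hN
  obtain ⟨y, hy, -, hy2⟩ := key n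
  rw [hn, Subgroup.mem_bot] at hy
  exact hy2 (by rw [hy, one_pow])

theorem fittingSubgroup_SL_two_three :
    fittingSubgroup SL(2, ZMod 3) = quaternionHom.range := by
  refine le_antisymm (sSup_le ?_) (le_sSup ⟨inferInstance, ?_⟩)
  · rintro N ⟨_, hN⟩
    exact le_range_quaternionHom_of_isNilpotent N hN
  · have := isPGroup_quaternionGroup_two.isNilpotent
    exact Group.nilpotent_of_surjective _ quaternionHom.rangeRestrict_surjective

theorem map_fittingSubgroup {G H : Type} [Group G] [Group H] (e : G ≃* H) :
    (fittingSubgroup G).map e.toMonoidHom = fittingSubgroup H := by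
  have key {G H : Type} [Group G] [Group H] (e : G ≃* H) :
      (fittingSubgroup G).map e.toMonoidHom ≤ fittingSubgroup H := by
    rw [Subgroup.map_le_iff_le_comap]
    refine sSup_le fun N ⟨hN, hN'⟩ => ?_
    rw [← Subgroup.map_le_iff_le_comap]
    refine le_sSup ⟨hN.map _ e.surjective, ?_⟩
    exact Group.nilpotent_of_mulEquiv (e.subgroupMap N)
  refine le_antisymm (key e) fun x hx => ?_
  refine ⟨e.symm x, key e.symm ⟨x, hx, rfl⟩, e.apply_symm_apply x⟩

instance isSolvable_SL_two_three : Group.IsSolvable SL(2, ZMod 3) := by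
  have h3 : Nat.card (SL(2, ZMod 3) ⧸ quaternionHom.range) = 3 := by
    have h := Subgroup.card_eq_card_quotient_mul_card_subgroup quaternionHom.range
    rw [Nat.card_eq_fintype_card (α := SL(2, ZMod 3)), card_SL_two_three,
      ← Nat.card_congr (MonoidHom.ofInjective quaternionHom_injective).toEquiv,
      Nat.card_eq_fintype_card (α := QuaternionGroup 2), QuaternionGroup.card] at h
    omega
  have : Fact (Nat.Prime 3) := ⟨Nat.prime_three⟩
  have := isCyclic_of_prime_card h3
  have := isPGroup_quaternionGroup_two.isNilpotent
  exact Group.isSolvable_of_ker_le_range quaternionHom (QuotientGroup.mk' quaternionHom.range)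
    (QuotientGroup.ker_mk' _).le

/-! ### The extra-special group of order `5 ^ 3` and exponent `5` -/

/-- The Heisenberg group over `ZMod 5`: the set `(ZMod 5)² × ZMod 5` with the multiplication
`(v, z) * (w, t) = (v + w, z + t + ω v w)`, where `ω (x, y) (x', y') = x * y' - y * x'`. The
form `ω` is not halved; the commutator of `(v, z)` and `(w, t)` is `(0, 2 * ω v w)`. -/
@[ext]
structure Heis where
  /-- The first coordinate in the symplectic plane. -/
  x : ZMod 5
  /-- The second coordinate in the symplectic plane. -/
  y : ZMod 5
  /-- The central coordinate. -/
  z : ZMod 5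

namespace Heis

instance : Group Heis where
  mul e f := ⟨e.x + f.x, e.y + f.y, e.z + f.z + (e.x * f.y - e.y * f.x)⟩
  one := ⟨0, 0, 0⟩
  inv e := ⟨-e.x, -e.y, -e.z⟩
  mul_assoc e f g := Heis.ext (add_assoc ..) (add_assoc ..) <| by
    change e.z + f.z + (e.x * f.y - e.y * f.x) + g.z +
      ((e.x + f.x) * g.y - (e.y + f.y) * g.x) = e.z + (f.z + g.z + (f.x * g.y - f.y * g.x)) +
      (e.x * (f.y + g.y) - e.y * (f.x + g.x))
    ring
  one_mul e := Heis.ext (zero_add _) (zero_add _) <| by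
    change 0 + e.z + (0 * e.y - 0 * e.x) = e.z
    ring
  mul_one e := Heis.ext (add_zero _) (add_zero _) <| by
    change e.z + 0 + (e.x * 0 - e.y * 0) = e.z
    ring
  inv_mul_cancel e := Heis.ext (neg_add_cancel _) (neg_add_cancel _) <| by
    change -e.z + e.z + (-e.x * e.y - -e.y * e.x) = 0
    ring

@[simp] theorem mul_x (e f : Heis) : (e * f).x = e.x + f.x := rfl
@[simp] theorem mul_y (e f : Heis) : (e * f).y = e.y + f.y := rfl
@[simp] theorem mul_z (e f : Heis) : (e * f).z = e.z + f.z + (e.x * f.y - e.y * f.x) := rfl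
@[simp] theorem one_x : (1 : Heis).x = 0 := rfl
@[simp] theorem one_y : (1 : Heis).y = 0 := rfl
@[simp] theorem one_z : (1 : Heis).z = 0 := rfl
@[simp] theorem inv_x (e : Heis) : e⁻¹.x = -e.x := rfl
@[simp] theorem inv_y (e : Heis) : e⁻¹.y = -e.y := rfl
@[simp] theorem inv_z (e : Heis) : e⁻¹.z = -e.z := rfl

/-- The Heisenberg group as a set of triples. -/
def equivProd : Heis ≃ ZMod 5 × ZMod 5 × ZMod 5 where
  toFun e := (e.x, e.y, e.z)
  invFun t := ⟨t.1, t.2.1, t.2.2⟩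
  left_inv _ := rfl
  right_inv _ := rfl

instance : Fintype Heis := Fintype.ofEquiv _ equivProd.symm

theorem card_eq : Nat.card Heis = 5 ^ 3 := by
  rw [Nat.card_congr equivProd]
  simp

theorem pow_five (e : Heis) : e ^ 5 = 1 := by
  have h5 : (5 : ZMod 5) = 0 := rfl
  ext <;> simp only [pow_succ, pow_zero, one_mul, mul_x, mul_y, mul_z, one_x, one_y, one_z]
  · linear_combination e.x * h5
  · linear_combination e.y * h5
  · linear_combination e.z * h5

theorem exponent_eq : Monoid.exponent Heis = 5 := by
  have hd : Monoid.exponent Heis ∣ 5 := Monoid.exponent_dvd_of_forall_pow_eq_one pow_five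
  refine ((Nat.dvd_prime Nat.prime_five).1 hd).resolve_left fun h => ?_
  have h1 := Monoid.pow_exponent_eq_one (⟨1, 0, 0⟩ : Heis)
  rw [h, pow_one] at h1
  exact absurd (congrArg Heis.x h1) (by decide)

theorem isPGroup : IsPGroup 5 Heis := IsPGroup.of_card card_eq

theorem mem_center {e : Heis} : e ∈ Subgroup.center Heis ↔ e.x = 0 ∧ e.y = 0 := by
  rw [Subgroup.mem_center_iff]
  constructor
  · intro h
    have h1 := congrArg Heis.z (h ⟨1, 0, 0⟩)
    have h2 := congrArg Heis.z (h ⟨0, 1, 0⟩)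
    simp only [mul_z] at h1 h2
    have h3 : (3 : ZMod 5) * 2 = 1 := by decide
    constructor
    · linear_combination -3 * h2 - e.x * h3
    · linear_combination 3 * h1 - e.y * h3
  · rintro ⟨hx, hy⟩ f
    ext <;> simp [hx, hy, add_comm]

theorem center_eq_commutator : Subgroup.center Heis = commutator Heis := by
  refine le_antisymm (fun e he => ?_) ?_
  · obtain ⟨hx, hy⟩ := mem_center.1 he
    -- `3` is the inverse of `2`
    have h : e = ⁅(⟨1, 0, 0⟩ : Heis), ⟨0, 3 * e.z, 0⟩⁆ := by
      have h5 : (5 : ZMod 5) = 0 := rfl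
      ext <;> simp [commutatorElement_def, hx, hy]
      linear_combination -e.z * h5
    rw [h]
    exact Subgroup.commutator_mem_commutator (Subgroup.mem_top _) (Subgroup.mem_top _)
  · rw [commutator_def, Subgroup.commutator_le]
    intro e _ f _
    rw [mem_center]
    simp [commutatorElement_def]

theorem card_center : Nat.card (Subgroup.center Heis) = 5 := by
  let φ : Subgroup.center Heis ≃ ZMod 5 :=
    { toFun e := e.1.z
      invFun t := ⟨⟨0, 0, t⟩, mem_center.2 ⟨rfl, rfl⟩⟩
      left_inv e := Subtype.ext (Heis.ext (mem_center.1 e.2).1.symm (mem_center.1 e.2).2.symm rfl)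
      right_inv _ := rfl }
  rw [Nat.card_congr φ, Nat.card_zmod]

theorem isExtraspecial : IsExtraspecial 5 Heis :=
  ⟨inferInstance, isPGroup, center_eq_commutator, card_center, fun e => by
    rw [pow_five]
    exact one_mem _⟩

/-- The action of `SL(2,5)` on the Heisenberg group through the symplectic plane. -/
def symplecticAut : SL(2, ZMod 5) →* MulAut Heis where
  toFun g :=
    { toFun e := ⟨g 0 0 * e.x + g 0 1 * e.y, g 1 0 * e.x + g 1 1 * e.y, e.z⟩
      invFun e := ⟨g 1 1 * e.x - g 0 1 * e.y, -g 1 0 * e.x + g 0 0 * e.y, e.z⟩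
      left_inv e := by
        have hd := (Matrix.det_fin_two g.1).symm.trans g.2
        ext
        · linear_combination e.x * hd
        · linear_combination e.y * hd
        · rfl
      right_inv e := by
        have hd := (Matrix.det_fin_two g.1).symm.trans g.2
        ext
        · linear_combination e.x * hd
        · linear_combination e.y * hd
        · rfl
      map_mul' e f := by
        have hd := (Matrix.det_fin_two g.1).symm.trans g.2
        ext <;> simp only [mul_x, mul_y, mul_z]
        · ring
        · ring
        · linear_combination -(e.x * f.y - e.y * f.x) * hd }
  map_one' := by ext e <;> simp
  map_mul' g h := by
    ext e <;> simp [Matrix.mul_apply, Fin.sum_univ_two] <;> ring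

@[simp] theorem symplecticAut_x (g : SL(2, ZMod 5)) (e : Heis) :
    (symplecticAut g e).x = g 0 0 * e.x + g 0 1 * e.y := rfl
@[simp] theorem symplecticAut_y (g : SL(2, ZMod 5)) (e : Heis) :
    (symplecticAut g e).y = g 1 0 * e.x + g 1 1 * e.y := rfl
@[simp] theorem symplecticAut_z (g : SL(2, ZMod 5)) (e : Heis) :
    (symplecticAut g e).z = e.z := rfl

end Heis

theorem IsExtraspecial.of_mulEquiv {p : ℕ} {A B : Type} [Group A] [Group B] (e : A ≃* B)
    (h : IsExtraspecial p A) : IsExtraspecial p B := by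
  obtain ⟨hfin, hp, hc, hcard, hpow⟩ := h
  have hcenter : (Subgroup.center A).map e.toMonoidHom = Subgroup.center B := by
    ext b
    simp only [Subgroup.mem_map, Subgroup.mem_center_iff]
    constructor
    · rintro ⟨a, ha, rfl⟩ c
      obtain ⟨c, rfl⟩ := e.surjective c
      simpa using congrArg e (ha c)
    · intro hb
      refine ⟨e.symm b, fun c => e.injective ?_, by simp⟩
      simpa using hb (e c)
  refine ⟨.of_equiv _ e.toEquiv, hp.of_equiv e, ?_, ?_, fun b => ?_⟩
  · rw [← hcenter, hc, commutator_def, commutator_def, Subgroup.map_commutator,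
      Subgroup.map_top_of_surjective _ e.surjective]
  · rw [← hcenter, ← hcard]
    exact (Nat.card_congr (e.subgroupMap _).toEquiv).symm
  · rw [← hcenter]
    refine ⟨e.symm b ^ p, hpow _, by simp⟩

/-! ### Irreducibility of matrix representations by the norm of the character -/

/-- By Maschke's theorem a proper nonzero subrepresentation would be the range of an equivariant
projection, which is not a scalar. -/
theorem Representation.isIrreducible_of_finrank_intertwiningMap_eq_one {G V : Type*} [Group G]
    [Finite G] [AddCommGroup V] [Module ℂ V] (ρ : Representation ℂ G V)
    (h : Module.finrank ℂ (ρ.IntertwiningMap ρ) = 1) : ρ.IsIrreducible := by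
  have : NeZero (Nat.card G : ℂ) := ⟨Nat.cast_ne_zero.2 Nat.card_pos.ne'⟩
  rw [Representation.irreducible_iff_isSimpleModule_asModule, isSimpleModule_iff]
  rw [(Representation.IntertwiningMap.equivAlgEnd (ρ := ρ)).toLinearEquiv.finrank_eq] at h
  have hV : Nontrivial ρ.asModule := by
    by_contra hV
    rw [not_nontrivial_iff_subsingleton] at hV
    rw [Module.finrank_zero_of_subsingleton] at h
    exact zero_ne_one h
  refine { exists_pair_ne := exists_pair_ne _, eq_bot_or_eq_top := fun p => ?_ }
  obtain ⟨q, hpq⟩ := exists_isCompl p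
  have h1 : (1 : Module.End (MonoidAlgebra ℂ G) ρ.asModule) ≠ 0 := one_ne_zero
  obtain ⟨c, hc⟩ := (finrank_eq_one_iff_of_nonzero' _ h1).1 h (p.projection q hpq)
  have hc' (x : ρ.asModule) : p.projection q hpq x = c • x := by rw [← hc]; rfl
  by_cases h0 : c = 0
  · left
    rw [← Submodule.range_projection hpq, eq_bot_iff]
    rintro _ ⟨x, rfl⟩
    rw [hc', h0, zero_smul]
    exact zero_mem _
  · right
    rw [eq_top_iff]
    intro x _
    have hx : p.projection q hpq (c⁻¹ • x) = x := by rw [hc', smul_inv_smul₀ h0]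
    rw [← hx]
    exact Submodule.projection_apply_mem hpq _

/-- The trace of a matrix representation is an irreducible character if it has norm one. -/
theorem isIrrChar_trace {G n : Type} [Group G] [Fintype G] [Fintype n] [DecidableEq n]
    (M : G →* Matrix n n ℂ)
    (h : ∑ g, (M g).trace * (M g⁻¹).trace = Nat.card G) : IsIrrChar fun g => (M g).trace := by
  let ρ : Representation ℂ G (n → ℂ) :=
    (Matrix.toLinAlgEquiv' (R := ℂ) (n := n) : Matrix n n ℂ →* Module.End ℂ (n → ℂ)).comp M
  have hρ : ρ.character = fun g => (M g).trace := by
    ext g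
    exact Matrix.trace_toLin'_eq (M g)
  refine ⟨n → ℂ, inferInstance, inferInstance, inferInstance, ρ, ?_, hρ⟩
  have hG : (Nat.card G : ℂ) ≠ 0 := Nat.cast_ne_zero.2 Nat.card_pos.ne'
  have : Invertible (Nat.card G : ℂ) := invertibleOfNonzero hG
  refine ρ.isIrreducible_of_finrank_intertwiningMap_eq_one ?_
  have key := Representation.card_inv_mul_sum_char_mul_char_eq_finrank ρ ρ
  rw [hρ, h, inv_mul_cancel₀ hG] at key
  exact_mod_cast key.symm

/-- The matrices of the representation of `N ⋊ H` induced from a linear character `l` of `N`. -/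
def inducedHom {N H : Type*} [Group N] [Group H] [Fintype H] [DecidableEq H] (φ : H →* MulAut N)
    (l : N →* ℂ) : N ⋊[φ] H →* Matrix H H ℂ where
  toFun g := .of fun k k' => if k = g.right * k' then l (φ k⁻¹ g.left) else 0
  map_one' := by
    ext k k'
    simp [Matrix.one_apply]
  map_mul' g g' := by
    ext k k'
    have h (j : H) : (k = g.right * j) ↔ (j = g.right⁻¹ * k) := by
      rw [eq_inv_mul_iff_mul_eq, eq_comm]
    simp only [Matrix.mul_apply, Matrix.of_apply, h, ite_mul, zero_mul, Finset.sum_ite_eq',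
      Finset.mem_univ, if_true, SemidirectProduct.mul_right, SemidirectProduct.mul_left, mul_assoc]
    by_cases hk : g'.right * k' = g.right⁻¹ * k
    · rw [if_pos hk, if_pos hk.symm, mul_inv_rev, inv_inv, map_mul, map_mul, map_mul,
        MulAut.mul_apply]
    · rw [if_neg hk, if_neg (Ne.symm hk), mul_zero]

theorem trace_inducedHom {N H : Type*} [Group N] [Group H] [Fintype H] [DecidableEq H]
    (φ : H →* MulAut N) (l : N →* ℂ) (g : N ⋊[φ] H) :
    (inducedHom φ l g).trace = if g.right = 1 then ∑ k, l (φ k g.left) else 0 := by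
  simp only [inducedHom, MonoidHom.coe_mk, OneHom.coe_mk, Matrix.trace, Matrix.diag,
    Matrix.of_apply, right_eq_mul]
  split_ifs
  · exact Fintype.sum_equiv (Equiv.inv H) _ _ fun k => rfl
  · simp

/-! ### The semidirect product -/

/-- The semidirect product of the Heisenberg group over `ZMod 5` and `SL(2,3)`, which acts on the
symplectic plane as the Hurwitz units modulo `5`. -/
abbrev HeisSL : Type := Heis ⋊[Heis.symplecticAut.comp embedSL] SL(2, ZMod 3)

instance : Fintype HeisSL := Fintype.ofEquiv _ SemidirectProduct.equivProd.symm

theorem card_heisSL : Nat.card HeisSL = 3000 := by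
  rw [SemidirectProduct.card, Heis.card_eq, Nat.card_eq_fintype_card, card_SL_two_three]
  norm_num

/-- The sum over the group of a function that depends, on the elements outside `E`, only on the
component in `SL(2,3)`, and is constant on the center of `E` and on its complement in `E`. -/
theorem sum_heisSL (f : HeisSL → ℂ) (A B : ℂ) (F : SL(2, ZMod 3) → ℂ)
    (hA : ∀ e : Heis, e.x = 0 ∧ e.y = 0 → f ⟨e, 1⟩ = A)
    (hB : ∀ e : Heis, ¬ (e.x = 0 ∧ e.y = 0) → f ⟨e, 1⟩ = B)
    (hF : ∀ (e : Heis) (h : SL(2, ZMod 3)), h ≠ 1 → f ⟨e, h⟩ = F h) :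
    ∑ g, f g = 5 * A + 120 * B + 125 * (∑ h, F h - F 1) := by
  have h1 : ∑ e : Heis, f ⟨e, 1⟩ = 5 * A + 120 * B := by
    let F' (t : ZMod 5 × ZMod 5 × ZMod 5) : ℂ := if t.1 = 0 ∧ t.2.1 = 0 then A else B
    have h (e : Heis) : f ⟨e, 1⟩ = F' (Heis.equivProd e) := by
      dsimp only [F', Heis.equivProd, Equiv.coe_fn_mk]
      split_ifs with he
      exacts [hA e he, hB e he]
    rw [Fintype.sum_equiv Heis.equivProd _ F' h, Finset.sum_ite, Finset.sum_const,
      Finset.sum_const]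
    have c1 : (Finset.univ.filter fun t : ZMod 5 × ZMod 5 × ZMod 5 =>
      t.1 = 0 ∧ t.2.1 = 0).card = 5 := by decide
    have c2 : (Finset.univ.filter fun t : ZMod 5 × ZMod 5 × ZMod 5 =>
      ¬ (t.1 = 0 ∧ t.2.1 = 0)).card = 120 := by decide +kernel
    rw [c1, c2]
    simp
  have hcard : Fintype.card Heis = 125 := by
    rw [← Nat.card_eq_fintype_card, Heis.card_eq]
    norm_num
  rw [Fintype.sum_equiv SemidirectProduct.equivProd f (fun p => f ⟨p.1, p.2⟩) fun _ => rfl,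
    Fintype.sum_prod_type_right,
    ← Finset.add_sum_erase _ _ (Finset.mem_univ (1 : SL(2, ZMod 3))), h1,
    ← Finset.add_sum_erase _ F (Finset.mem_univ (1 : SL(2, ZMod 3))), add_sub_cancel_left,
    Finset.mul_sum]
  congr 1
  refine Finset.sum_congr rfl fun h hh => ?_
  rw [Finset.sum_congr rfl fun e _ => hF e h (Finset.ne_of_mem_erase hh)]
  simp [hcard]

instance : Fact (Nat.Prime 5) := ⟨Nat.prime_five⟩

/-- A matrix of determinant `1` with the eigenvalue `1` has trace `2`. -/
theorem trace_eq_two_of_fixed {g : SL(2, ZMod 5)} {x y : ZMod 5} (hxy : ¬ (x = 0 ∧ y = 0))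
    (hx : g 0 0 * x + g 0 1 * y = x) (hy : g 1 0 * x + g 1 1 * y = y) :
    g 0 0 + g 1 1 = 2 := by
  have hd := (Matrix.det_fin_two g.1).symm.trans g.2
  have h1 : (g 0 0 + g 1 1 - 2) * x = 0 := by
    linear_combination x * hd - (g 1 1 - 1) * hx + g 0 1 * hy
  have h2 : (g 0 0 + g 1 1 - 2) * y = 0 := by
    linear_combination y * hd - (g 0 0 - 1) * hy + g 1 0 * hx
  by_contra h
  have h' : g 0 0 + g 1 1 - 2 ≠ 0 := sub_ne_zero.2 h
  exact hxy ⟨(mul_eq_zero.1 h1).resolve_left h', (mul_eq_zero.1 h2).resolve_left h'⟩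

/-- The group `SL(2,3)` acts regularly on the `24` nonzero vectors of the symplectic plane. -/
theorem orbit_bijective (e : Heis) (he : ¬ (e.x = 0 ∧ e.y = 0)) :
    Function.Bijective fun k : SL(2, ZMod 3) =>
      (⟨((Heis.symplecticAut (embedSL k) e).x, (Heis.symplecticAut (embedSL k) e).y), by
        intro h
        rw [Prod.mk_eq_zero, ← Heis.mem_center] at h
        have h' := (MulEquivClass.apply_mem_center_iff (Heis.symplecticAut (embedSL k))).1 h
        exact he (Heis.mem_center.1 h')⟩ : {p : ZMod 5 × ZMod 5 // p ≠ 0}) := by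
  rw [Fintype.bijective_iff_injective_and_card]
  refine ⟨fun k k' h => ?_, by rw [card_SL_two_three]; decide⟩
  by_contra hk
  have hk' : k'⁻¹ * k ≠ 1 := fun h1 => hk (inv_mul_eq_one.1 h1).symm
  refine embedSL_trace_ne_two hk' ?_
  rw [Subtype.mk.injEq, Prod.mk.injEq] at h
  have hz : Heis.symplecticAut (embedSL k) e = Heis.symplecticAut (embedSL k') e :=
    Heis.ext h.1 h.2 rfl
  have hfix : Heis.symplecticAut (embedSL (k'⁻¹ * k)) e = e := by
    rw [map_mul, map_mul, MulAut.mul_apply, hz, map_inv, map_inv, MulAut.inv_apply_self]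
  exact trace_eq_two_of_fixed he (congrArg Heis.x hfix) (congrArg Heis.y hfix)

/-! ### The Weil representation of `SL(2,5)` -/

/-- The standard additive character of `ZMod 5`. -/
local notation "ψ" => (ZMod.stdAddChar : AddChar (ZMod 5) ℂ)

/-- The quadratic character of `ZMod 5` with complex values. -/
noncomputable def quadChar (a : ZMod 5) : ℂ := (quadraticChar (ZMod 5) a : ℂ)

theorem quadChar_mul (a b : ZMod 5) : quadChar (a * b) = quadChar a * quadChar b := by
  rw [quadChar, map_mul, Int.cast_mul, quadChar, quadChar]

theorem quadChar_one : quadChar 1 = 1 := by simp [quadChar]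

theorem quadChar_neg (a : ZMod 5) : quadChar (-a) = quadChar a := by
  have h : ∀ a : ZMod 5, quadraticChar (ZMod 5) (-a) = quadraticChar (ZMod 5) a := by decide
  rw [quadChar, h, quadChar]

theorem quadChar_mul_self {a : ZMod 5} (ha : a ≠ 0) : quadChar a * quadChar a = 1 := by
  have h := quadraticChar_sq_one ha
  rw [quadChar, ← sq]
  exact_mod_cast h

theorem quadChar_eq_of_mul_eq_one {a d : ZMod 5} (h : a * d = 1) : quadChar a = quadChar d := by
  have h1 := quadChar_mul a d
  rw [h, quadChar_one] at h1
  linear_combination -quadChar d * h1 -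
    quadChar a * quadChar_mul_self (right_ne_zero_of_mul_eq_one h)

theorem quadChar_inv (a : ZMod 5) : quadChar a⁻¹ = quadChar a := by
  by_cases ha : a = 0
  · rw [ha, inv_zero]
  · exact quadChar_eq_of_mul_eq_one (inv_mul_cancel₀ ha)

theorem conj_quadChar (a : ZMod 5) : conj (quadChar a) = quadChar a := by simp [quadChar]

theorem conj_stdAddChar (a : ZMod 5) : conj (ψ a) = ψ (-a) := (AddChar.map_neg_eq_conj _ _).symm

theorem sum_stdAddChar_eq_zero : ∑ a, ψ a = 0 :=
  AddChar.sum_eq_zero_of_ne_one fun h => by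
    have h1 := ZMod.injective_stdAddChar (N := 5) (a₁ := 1) (a₂ := 0) (by rw [h]; simp)
    exact absurd h1 (by decide)

theorem sum_stdAddChar_linear {l : ZMod 5} (hl : l ≠ 0) (m : ZMod 5) :
    ∑ t, ψ (l * t + m) = 0 := by
  rw [← sum_stdAddChar_eq_zero]
  exact Fintype.sum_equiv ((Equiv.mulLeft₀ l hl).trans (Equiv.addRight m)) _ _ fun t => rfl

/-- The quadratic Gauss sum over `ZMod 5`, which is a square root of `5`. -/
noncomputable def gauss : ℂ := ∑ t, ψ (t ^ 2)

theorem sum_zmod_five (f : ZMod 5 → ℂ) : ∑ t, f t = f 0 + f 1 + f 2 + f 3 + f 4 :=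
  Fin.sum_univ_five f

theorem gauss_eq : gauss = 1 + 2 * ψ 1 + 2 * ψ 4 := by
  rw [gauss, sum_zmod_five, show (0 : ZMod 5) ^ 2 = 0 by decide, show (1 : ZMod 5) ^ 2 = 1 by decide,
    show (2 : ZMod 5) ^ 2 = 4 by decide, show (3 : ZMod 5) ^ 2 = 4 by decide,
    show (4 : ZMod 5) ^ 2 = 1 by decide, AddChar.map_zero_eq_one]
  ring

theorem conj_gauss : conj gauss = gauss := by
  rw [gauss_eq]
  simp only [map_add, map_mul, map_one, conj_stdAddChar, map_ofNat]
  rw [show (-1 : ZMod 5) = 4 by decide, show (-4 : ZMod 5) = 1 by decide]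
  ring

theorem gauss_mul_self : gauss * gauss = 5 := by
  have hs := sum_stdAddChar_eq_zero
  rw [sum_zmod_five, AddChar.map_zero_eq_one] at hs
  have h11 : ψ 1 * ψ 1 = ψ 2 := by rw [← AddChar.map_add_eq_mul]; rfl
  have h44 : ψ 4 * ψ 4 = ψ 3 := by rw [← AddChar.map_add_eq_mul]; rfl
  have h14 : ψ 1 * ψ 4 = 1 := by
    rw [← AddChar.map_add_eq_mul, ← AddChar.map_zero_eq_one ψ]; rfl
  rw [gauss_eq]
  linear_combination 4 * hs + 4 * h11 + 4 * h44 + 8 * h14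

theorem gauss_ne_zero : gauss ≠ 0 := fun h => by
  have := gauss_mul_self
  rw [h] at this
  norm_num at this

/-- Completing the square; `4 = -1` in `ZMod 5`. -/
theorem sum_stdAddChar_quadratic {q : ZMod 5} (hq : q ≠ 0) (l m : ZMod 5) :
    ∑ t, ψ (q * t ^ 2 + l * t + m) = quadChar q * gauss * ψ (m + l ^ 2 * q⁻¹) := by
  have h5 : (5 : ZMod 5) = 0 := rfl
  have hc : ∑ t, ψ (q * t ^ 2 + l * t + m) = ∑ t, ψ (q * t ^ 2) * ψ (m + l ^ 2 * q⁻¹) := by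
    refine Fintype.sum_equiv (Equiv.addRight (-2 * l * q⁻¹)) _ _ fun t => ?_
    rw [← AddChar.map_add_eq_mul, Equiv.coe_addRight]
    congr 1
    field_simp
    linear_combination (q * t * l - l ^ 2) * h5
  have hq' : ∑ t, ψ (q * t ^ 2) = quadChar q * gauss := by
    have hs := sum_stdAddChar_eq_zero
    rw [sum_zmod_five, AddChar.map_zero_eq_one] at hs
    have hall : ∀ q : ZMod 5, q ≠ 0 →
        (q * 1 ^ 2 = 1 ∧ q * 2 ^ 2 = 4 ∧ q * 3 ^ 2 = 4 ∧ q * 4 ^ 2 = 1 ∧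
          quadraticChar (ZMod 5) q = 1) ∨
        (q * 1 ^ 2 = 4 ∧ q * 2 ^ 2 = 1 ∧ q * 3 ^ 2 = 1 ∧ q * 4 ^ 2 = 4 ∧
          quadraticChar (ZMod 5) q = 1) ∨
        (q * 1 ^ 2 = 2 ∧ q * 2 ^ 2 = 3 ∧ q * 3 ^ 2 = 3 ∧ q * 4 ^ 2 = 2 ∧
          quadraticChar (ZMod 5) q = -1) ∨
        (q * 1 ^ 2 = 3 ∧ q * 2 ^ 2 = 2 ∧ q * 3 ^ 2 = 2 ∧ q * 4 ^ 2 = 3 ∧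
          quadraticChar (ZMod 5) q = -1) := by decide
    rw [gauss_eq, sum_zmod_five, quadChar, zero_pow two_ne_zero, mul_zero,
      AddChar.map_zero_eq_one]
    rcases hall q hq with ⟨h1, h2, h3, h4, h⟩ | ⟨h1, h2, h3, h4, h⟩ | ⟨h1, h2, h3, h4, h⟩ |
      ⟨h1, h2, h3, h4, h⟩ <;> rw [h1, h2, h3, h4, h] <;> push_cast
    · ring
    · ring
    · linear_combination 2 * hs
    · linear_combination 2 * hs
  rw [hc, ← Finset.sum_mul, hq']

/-- The kernel of the operator of the Weil representation on functions on `ZMod 5` attached to the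
matrix `!![a, b; c, d]`. -/
noncomputable def weilMatrix (g : SL(2, ZMod 5)) : Matrix (ZMod 5) (ZMod 5) ℂ :=
  .of fun s t =>
    if g 0 1 = 0 then
      if t = g 1 1 * s then quadChar (g 1 1) * ψ (-(g 1 0 * g 1 1 * s ^ 2)) else 0
    else quadChar (g 0 1) * gauss⁻¹ *
      ψ ((-(g 1 1 * s ^ 2) + 2 * s * t - g 0 0 * t ^ 2) * (g 0 1)⁻¹)

theorem weilMatrix_one : weilMatrix 1 = 1 := by
  ext s t
  simp [weilMatrix, Matrix.one_apply, quadChar_one, eq_comm]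

theorem weilMatrix_mul (g h : SL(2, ZMod 5)) :
    weilMatrix (g * h) = weilMatrix g * weilMatrix h := by
  have hg := (Matrix.det_fin_two g.1).symm.trans g.2
  have hh := (Matrix.det_fin_two h.1).symm.trans h.2
  ext s u
  simp only [weilMatrix, Matrix.mul_apply, Matrix.of_apply, Matrix.SpecialLinearGroup.coe_mul,
    Fin.sum_univ_two]
  generalize g 0 0 = a, g 0 1 = b, g 1 0 = c, g 1 1 = d at *
  generalize h 0 0 = a', h 0 1 = b', h 1 0 = c', h 1 1 = d' at *
  have hγ := gauss_ne_zero
  by_cases hb : b = 0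
  · subst hb
    simp only [zero_mul, add_zero, sub_zero, if_true, ite_mul, Finset.sum_ite_eq',
      Finset.mem_univ] at hg ⊢
    by_cases hb' : b' = 0
    · subst hb'
      simp only [zero_mul, mul_zero, zero_add, sub_zero, if_true, mul_ite] at hh ⊢
      by_cases hu : u = d' * (d * s)
      · rw [if_pos (by rw [hu]; ring), if_pos hu, quadChar_mul, mul_mul_mul_comm,
          ← AddChar.map_add_eq_mul]
        congr 2
        linear_combination -(c * d * s ^ 2) * hh
      · rw [if_neg (by contrapose hu; rw [hu]; ring), if_neg hu]
    · have ha : a ≠ 0 := left_ne_zero_of_mul_eq_one hg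
      have hd : d = a⁻¹ := eq_inv_of_mul_eq_one_right hg
      rw [if_neg (mul_ne_zero ha hb'), if_neg hb', quadChar_mul, quadChar_eq_of_mul_eq_one hg,
        mul_mul_mul_comm, ← AddChar.map_add_eq_mul, ← mul_assoc]
      congr 2
      rw [hd]
      field_simp
      ring
  · have hc : c = (a * d - 1) * b⁻¹ := by
      field_simp
      linear_combination -hg
    by_cases hb' : b' = 0
    · subst hb'
      simp only [zero_mul, mul_zero, zero_add, sub_zero, if_true, mul_ite, if_neg hb] at hh ⊢
      have ha' : a' ≠ 0 := left_ne_zero_of_mul_eq_one hh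
      have hd' : d' = a'⁻¹ := eq_inv_of_mul_eq_one_right hh
      have ht (t : ZMod 5) : u = d' * t ↔ t = a' * u := by
        rw [hd', eq_comm, inv_mul_eq_iff_eq_mul₀ ha']
      simp only [ht, Finset.sum_ite_eq', Finset.mem_univ, if_true]
      rw [if_neg (mul_ne_zero hb (right_ne_zero_of_mul_eq_one hh)), quadChar_mul,
        mul_mul_mul_comm, ← AddChar.map_add_eq_mul, mul_right_comm (quadChar b) (quadChar d')]
      congr 2
      rw [hd']
      field_simp
      ring
    · have hc' : c' = (a' * d' - 1) * b'⁻¹ := by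
        field_simp
        linear_combination -hh
      have hsum : ∑ t, quadChar b * gauss⁻¹ * ψ ((-(d * s ^ 2) + 2 * s * t - a * t ^ 2) * b⁻¹) *
          (quadChar b' * gauss⁻¹ * ψ ((-(d' * t ^ 2) + 2 * t * u - a' * u ^ 2) * b'⁻¹)) =
          quadChar b * quadChar b' * (gauss⁻¹ * gauss⁻¹) *
            ∑ t, ψ (-((a * b' + b * d') * (b⁻¹ * b'⁻¹)) * t ^ 2 +
              2 * (s * b⁻¹ + u * b'⁻¹) * t + (-(d * s ^ 2 * b⁻¹) - a' * u ^ 2 * b'⁻¹)) := by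
        rw [Finset.mul_sum]
        refine Finset.sum_congr rfl fun t _ => ?_
        rw [mul_mul_mul_comm, ← AddChar.map_add_eq_mul, mul_mul_mul_comm (quadChar b)]
        congr 2
        field_simp
        ring
      simp only [if_neg hb, if_neg hb', hsum]
      by_cases hbb : a * b' + b * d' = 0
      · have hd : c * b' + d * d' = -(b' * b⁻¹) := by
          rw [hc]
          field_simp
          linear_combination d * hbb
        have hu : u = (c * b' + d * d') * s ↔ s * b⁻¹ + u * b'⁻¹ = 0 := by
          rw [hd]
          field_simp
          rw [← sub_eq_zero (b := -(b' * s))]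
          ring_nf
        simp only [hbb, zero_mul, neg_zero, zero_add, if_true, hu]
        split_ifs with hl
        · simp only [hl, mul_zero, zero_mul, zero_add, Finset.sum_const, Finset.card_univ,
            ZMod.card, nsmul_eq_mul]
          have hγ' : gauss⁻¹ * gauss⁻¹ * 5 = 1 := by
            rw [← gauss_mul_self]
            field_simp
          push_cast
          rw [← mul_assoc _ (5 : ℂ), mul_assoc (quadChar b * quadChar b'), hγ', mul_one, hd, quadChar_neg, quadChar_mul,
            quadChar_inv, mul_comm (quadChar b')]
          congr 2
          rw [← hu, hd] at hl
          rw [hl, hc, hc']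
          field_simp
          linear_combination a' * d * s ^ 2 * hbb
        · have h2 : (2 : ZMod 5) ≠ 0 := by decide
          rw [sum_stdAddChar_linear (mul_ne_zero h2 hl), mul_zero]
      · have hq : -((a * b' + b * d') * (b⁻¹ * b'⁻¹)) ≠ 0 :=
          neg_ne_zero.2 (mul_ne_zero hbb (mul_ne_zero (inv_ne_zero hb) (inv_ne_zero hb')))
        have hl : (2 * (s * b⁻¹ + u * b'⁻¹)) ^ 2 = -(s * b⁻¹ + u * b'⁻¹) ^ 2 := by
          have h5 : (5 : ZMod 5) = 0 := rfl
          linear_combination (s * b⁻¹ + u * b'⁻¹) ^ 2 * h5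
        rw [if_neg hbb, sum_stdAddChar_quadratic hq, quadChar_neg, quadChar_mul, quadChar_mul,
          quadChar_inv, quadChar_inv, hl]
        have hκ : quadChar (a * b' + b * d') * gauss⁻¹ =
            quadChar b * quadChar b' * (gauss⁻¹ * gauss⁻¹) *
              (quadChar (a * b' + b * d') * (quadChar b * quadChar b') * gauss) := by
          have h1 := quadChar_mul_self hb
          have h2 := quadChar_mul_self hb'
          field_simp
          linear_combination -quadChar (a * b' + b * d') * (quadChar b' ^ 2 * h1 + h2)
        rw [← mul_assoc, ← hκ]
        congr 2
        rw [hc, hc']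
        field_simp
        ring

/-- The operators of the Weil representation are unitary. -/
theorem weilMatrix_inv (g : SL(2, ZMod 5)) :
    weilMatrix g⁻¹ = (weilMatrix g).conjTranspose := by
  have hg := (Matrix.det_fin_two g.1).symm.trans g.2
  ext s t
  simp only [weilMatrix, Matrix.of_apply, Matrix.conjTranspose_apply,
    Matrix.SpecialLinearGroup.SL2_inv_expl g]
  simp only [Matrix.cons_val', Matrix.cons_val_zero, Matrix.cons_val_one,
    Matrix.cons_val_fin_one, neg_eq_zero]
  generalize g 0 0 = a, g 0 1 = b, g 1 0 = c, g 1 1 = d at *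
  by_cases hb : b = 0
  · subst hb
    rw [zero_mul, sub_zero] at hg
    have hd : d ≠ 0 := right_ne_zero_of_mul_eq_one hg
    have ha : a = d⁻¹ := eq_inv_of_mul_eq_one_left hg
    have hst : t = a * s ↔ s = d * t := by rw [ha, eq_inv_mul_iff_mul_eq₀ hd, eq_comm]
    simp only [if_true, hst]
    split_ifs with h
    · rw [quadChar_eq_of_mul_eq_one hg, RCLike.star_def, map_mul, conj_quadChar, conj_stdAddChar]
      congr 2
      rw [h, ha]
      field_simp
    · simp
  · simp only [if_neg hb, RCLike.star_def, map_mul, conj_quadChar, conj_stdAddChar, map_inv₀,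
      conj_gauss, quadChar_neg]
    congr 2
    field_simp
    ring

/-! ### The Schrödinger representation and the character of degree `5` -/

/-- The matrices of the Schrödinger representation of the Heisenberg group on functions on
`ZMod 5`. -/
noncomputable def schrodingerMatrix (e : Heis) : Matrix (ZMod 5) (ZMod 5) ℂ :=
  .of fun s t => if t = s + e.x then ψ (e.z + 2 * e.y * s + e.x * e.y) else 0

theorem schrodingerMatrix_mk (x y z s t : ZMod 5) :
    schrodingerMatrix ⟨x, y, z⟩ s t =
      if t = s + x then ψ (z + 2 * y * s + x * y) else 0 :=
  rfl

theorem schrodingerMatrix_one : schrodingerMatrix 1 = 1 := by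
  ext s t
  simp [schrodingerMatrix, Matrix.one_apply, eq_comm]

theorem schrodingerMatrix_mul (e f : Heis) :
    schrodingerMatrix (e * f) = schrodingerMatrix e * schrodingerMatrix f := by
  ext s t
  simp only [schrodingerMatrix, Matrix.mul_apply, Matrix.of_apply, ite_mul, zero_mul,
    Finset.sum_ite_eq', Finset.mem_univ, if_true, Heis.mul_x, Heis.mul_y, Heis.mul_z]
  simp only [mul_ite, mul_zero, ← AddChar.map_add_eq_mul, add_assoc]
  congr 2
  ring

theorem schrodingerMatrix_inv (e : Heis) :
    schrodingerMatrix e⁻¹ = (schrodingerMatrix e).conjTranspose := by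
  ext s t
  have h : t = s + -e.x ↔ s = t + e.x := by rw [← sub_eq_add_neg, eq_sub_iff_add_eq, eq_comm]
  simp only [schrodingerMatrix, Matrix.conjTranspose_apply, Matrix.of_apply, Heis.inv_x,
    Heis.inv_y, Heis.inv_z, h]
  split_ifs with hs
  · rw [RCLike.star_def, conj_stdAddChar, hs]
    congr 1
    ring
  · simp

/-- The operators of the Weil representation intertwine the Schrödinger representation with its
twists by the symplectic group. -/
theorem weilMatrix_mul_schrodingerMatrix (g : SL(2, ZMod 5)) (e : Heis) :
    weilMatrix g * schrodingerMatrix e =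
      schrodingerMatrix (Heis.symplecticAut g e) * weilMatrix g := by
  have hg := (Matrix.det_fin_two g.1).symm.trans g.2
  obtain ⟨x, y, z⟩ := e
  have he : Heis.symplecticAut g ⟨x, y, z⟩ =
    ⟨g 0 0 * x + g 0 1 * y, g 1 0 * x + g 1 1 * y, z⟩ := rfl
  rw [he]
  ext s t
  simp only [weilMatrix, schrodingerMatrix_mk, Matrix.mul_apply, Matrix.of_apply]
  generalize g 0 0 = a, g 0 1 = b, g 1 0 = c, g 1 1 = d at *
  by_cases hb : b = 0
  · subst hb
    rw [zero_mul, sub_zero] at hg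
    have hd : d ≠ 0 := right_ne_zero_of_mul_eq_one hg
    have ha : a = d⁻¹ := eq_inv_of_mul_eq_one_left hg
    have hst : t = d * (s + a * x) ↔ t = d * s + x := by
      rw [ha, mul_add, mul_inv_cancel_left₀ hd]
    simp only [if_true, ite_mul, zero_mul, add_zero, Finset.sum_ite_eq', Finset.mem_univ]
    simp only [mul_ite, mul_zero, hst]
    split_ifs with ht
    · rw [mul_left_comm (ψ _), mul_assoc (quadChar d), ← AddChar.map_add_eq_mul,
        ← AddChar.map_add_eq_mul, ha]
      congr 2
      field_simp
      ring
    · rfl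
  · have hc : c = (a * d - 1) * b⁻¹ := by
      field_simp
      linear_combination -hg
    have h (j : ZMod 5) : t = j + x ↔ j = t - x := by rw [eq_sub_iff_add_eq, eq_comm]
    simp only [if_neg hb, h, mul_ite, mul_zero, ite_mul, zero_mul, Finset.sum_ite_eq',
      Finset.mem_univ, if_true]
    rw [mul_left_comm, mul_assoc, ← AddChar.map_add_eq_mul, ← AddChar.map_add_eq_mul, hc]
    congr 2
    field_simp
    ring

/-- The representation of degree `5` of the semidirect product that extends the Schrödinger
representation. -/
noncomputable def weilHom : HeisSL →* Matrix (ZMod 5) (ZMod 5) ℂ where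
  toFun g := schrodingerMatrix g.left * weilMatrix (embedSL g.right)
  map_one' := by
    rw [SemidirectProduct.one_left, SemidirectProduct.one_right, map_one, schrodingerMatrix_one,
      weilMatrix_one, one_mul]
  map_mul' g h := by
    rw [SemidirectProduct.mul_left, SemidirectProduct.mul_right, map_mul, schrodingerMatrix_mul,
      weilMatrix_mul, mul_assoc, mul_assoc, MonoidHom.comp_apply, ← mul_assoc (weilMatrix _),
      weilMatrix_mul_schrodingerMatrix, mul_assoc]

theorem weilHom_inv (g : HeisSL) : weilHom g⁻¹ = (weilHom g).conjTranspose := by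
  change schrodingerMatrix (Heis.symplecticAut (embedSL g.right⁻¹) g.left⁻¹) *
    weilMatrix (embedSL g.right⁻¹) =
    (schrodingerMatrix g.left * weilMatrix (embedSL g.right)).conjTranspose
  rw [← weilMatrix_mul_schrodingerMatrix, map_inv, weilMatrix_inv, schrodingerMatrix_inv,
    Matrix.conjTranspose_mul]

theorem trace_weilHom_of_center {e : Heis} (he : e.x = 0 ∧ e.y = 0) :
    (weilHom ⟨e, 1⟩).trace = 5 * ψ e.z := by
  change (schrodingerMatrix e * weilMatrix (embedSL 1)).trace = _
  rw [map_one, weilMatrix_one, mul_one]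
  simp [Matrix.trace, schrodingerMatrix, he.1, he.2]

theorem trace_weilHom_of_not_center {e : Heis} (he : ¬ (e.x = 0 ∧ e.y = 0)) :
    (weilHom ⟨e, 1⟩).trace = 0 := by
  change (schrodingerMatrix e * weilMatrix (embedSL 1)).trace = _
  rw [map_one, weilMatrix_one, mul_one]
  simp only [Matrix.trace, Matrix.diag, schrodingerMatrix, Matrix.of_apply, left_eq_add]
  by_cases hx : e.x = 0
  · have hy : 2 * e.y ≠ 0 := mul_ne_zero (by decide) fun hy => he ⟨hx, hy⟩
    simp only [if_pos hx]
    rw [← sum_stdAddChar_linear hy (e.z + e.x * e.y)]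
    refine Finset.sum_congr rfl fun t _ => ?_
    congr 1
    ring
  · simp [hx]

/-- Outside `E`, the matrix is either monomial with a single nonzero entry on the diagonal, or its
trace is the quotient of two nondegenerate quadratic Gauss sums; so the trace is a root of unity up
to sign. -/
theorem trace_weilHom_mul_conj (e : Heis) {h : SL(2, ZMod 3)} (hh : h ≠ 1) :
    (weilHom ⟨e, h⟩).trace * conj (weilHom ⟨e, h⟩).trace = 1 := by
  have htr := embedSL_trace_ne_two hh
  have hg := (Matrix.det_fin_two (embedSL h).1).symm.trans (embedSL h).2
  have hψ (m : ZMod 5) : ψ m * conj (ψ m) = 1 := by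
    rw [conj_stdAddChar, ← AddChar.map_add_eq_mul, add_neg_cancel, AddChar.map_zero_eq_one]
  change (schrodingerMatrix e * weilMatrix (embedSL h)).trace *
    conj (schrodingerMatrix e * weilMatrix (embedSL h)).trace = 1
  suffices hs : ∃ r : ℂ, ∃ m, (schrodingerMatrix e * weilMatrix (embedSL h)).trace = r * ψ m ∧
      r * conj r = 1 by
    obtain ⟨r, m, hs, hr⟩ := hs
    rw [hs, map_mul, mul_mul_mul_comm, hr, hψ, one_mul]
  simp only [weilMatrix, schrodingerMatrix, Matrix.trace, Matrix.diag, Matrix.mul_apply,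
    Matrix.of_apply, ite_mul, zero_mul, Finset.sum_ite_eq', Finset.mem_univ, if_true]
  generalize (embedSL h) 0 0 = a, (embedSL h) 0 1 = b, (embedSL h) 1 0 = c,
    (embedSL h) 1 1 = d at *
  obtain ⟨x, y, z⟩ := e
  by_cases hb : b = 0
  · subst hb
    rw [zero_mul, sub_zero] at hg
    have hd : 1 - d ≠ 0 := by
      intro hd
      obtain rfl : d = 1 := (sub_eq_zero.1 hd).symm
      rw [mul_one] at hg
      exact htr (by rw [hg]; rfl)
    have hs (s : ZMod 5) : s = d * (s + x) ↔ s = d * x * (1 - d)⁻¹ := by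
      rw [eq_mul_inv_iff_mul_eq₀ hd, ← sub_eq_zero, ← sub_eq_zero (a := s * (1 - d))]
      ring_nf
    simp only [if_true, hs, mul_ite, mul_zero, Finset.sum_ite_eq', Finset.mem_univ]
    rw [mul_left_comm, ← AddChar.map_add_eq_mul]
    refine ⟨_, _, rfl, ?_⟩
    rw [conj_quadChar, quadChar_mul_self (right_ne_zero_of_mul_eq_one hg)]
  · have hq : (2 - (a + d)) * b⁻¹ ≠ 0 := mul_ne_zero (sub_ne_zero.2 htr.symm) (inv_ne_zero hb)
    simp only [if_neg hb]
    have hsum : ∑ s, ψ (z + 2 * y * s + x * y) * (quadChar b * gauss⁻¹ *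
        ψ ((-(d * (s + x) ^ 2) + 2 * (s + x) * s - a * s ^ 2) * b⁻¹)) =
        quadChar b * gauss⁻¹ * ∑ s, ψ ((2 - (a + d)) * b⁻¹ * s ^ 2 +
          (2 * y + (2 * x - 2 * d * x) * b⁻¹) * s + (z + x * y - d * x ^ 2 * b⁻¹)) := by
      rw [Finset.mul_sum]
      refine Finset.sum_congr rfl fun s _ => ?_
      rw [mul_left_comm, ← AddChar.map_add_eq_mul]
      congr 2
      ring
    rw [hsum, sum_stdAddChar_quadratic hq, ← mul_assoc, mul_mul_mul_comm,
      inv_mul_cancel₀ gauss_ne_zero]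
    refine ⟨_, _, rfl, ?_⟩
    rw [mul_one, map_mul, conj_quadChar, conj_quadChar, mul_mul_mul_comm, quadChar_mul_self hb,
      quadChar_mul_self hq, one_mul]

/-! ### The irreducible characters of degrees `3`, `24` and `10` -/

theorem sum_rotation_sq :
    ∑ h : SL(2, ZMod 3), ((hurwitz h 0 : ℂ) ^ 2 - 1) * ((hurwitz h 0 : ℂ) ^ 2 - 1) = 24 := by
  have h := congrArg (Int.cast : ℤ → ℂ) sum_hurwitz_zero_sq_sub_one_sq
  push_cast at h
  simpa only [sq (_ ^ 2 - 1 : ℂ)] using h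

/-- The character of degree `3`, inflated from the rotation representation of `SL(2,3)`. -/
noncomputable def charThree (g : HeisSL) : ℂ :=
  ((rotationHom.comp SemidirectProduct.rightHom) g).trace

theorem charThree_apply (g : HeisSL) : charThree g = (hurwitz g.right 0 : ℂ) ^ 2 - 1 :=
  trace_rotationHom g.right

theorem isIrrChar_charThree : IsIrrChar charThree := by
  refine isIrrChar_trace (rotationHom.comp SemidirectProduct.rightHom) ?_
  change ∑ g : HeisSL, charThree g * charThree g⁻¹ = _
  simp only [charThree_apply, SemidirectProduct.inv_right, hurwitz_inv_zero]
  rw [sum_heisSL _ 9 9 (fun h => ((hurwitz h 0 : ℂ) ^ 2 - 1) * ((hurwitz h 0 : ℂ) ^ 2 - 1)),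
    sum_rotation_sq, card_heisSL, hurwitz_one.1]
  · norm_num
  · intro e _
    norm_num [hurwitz_one.1]
  · intro e _
    norm_num [hurwitz_one.1]
  · intro e h _
    rfl

/-- A nontrivial linear character of the Heisenberg group. -/
noncomputable def Heis.linearChar : Heis →* ℂ where
  toFun e := ψ e.x
  map_one' := AddChar.map_zero_eq_one _
  map_mul' _ _ := AddChar.map_add_eq_mul _ _ _

/-- The character of degree `24`, induced from a nontrivial linear character of the Heisenberg
group. -/
noncomputable def charTwentyFour (g : HeisSL) : ℂ :=
  (inducedHom (Heis.symplecticAut.comp embedSL) Heis.linearChar g).trace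

theorem charTwentyFour_of_center {e : Heis} (he : e.x = 0 ∧ e.y = 0) :
    charTwentyFour ⟨e, 1⟩ = 24 := by
  rw [charTwentyFour, trace_inducedHom, if_pos rfl]
  have h (k : SL(2, ZMod 3)) :
      Heis.linearChar ((Heis.symplecticAut.comp embedSL) k e) = 1 := by
    change ψ (embedSL k 0 0 * e.x + embedSL k 0 1 * e.y) = 1
    rw [he.1, he.2, mul_zero, mul_zero, add_zero, AddChar.map_zero_eq_one]
  simp only [h, Finset.sum_const, Finset.card_univ, card_SL_two_three]
  norm_num

/-- The conjugates of the linear character are all the nontrivial ones, once each. -/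
theorem charTwentyFour_of_not_center {e : Heis} (he : ¬ (e.x = 0 ∧ e.y = 0)) :
    charTwentyFour ⟨e, 1⟩ = -1 := by
  rw [charTwentyFour, trace_inducedHom, if_pos rfl]
  have h1 : ∑ k, Heis.linearChar ((Heis.symplecticAut.comp embedSL) k e) =
      ∑ p : {p : ZMod 5 × ZMod 5 // p ≠ 0}, ψ p.1.1 :=
    Fintype.sum_bijective _ (orbit_bijective e he) _ _ fun k => rfl
  have h2 : ∑ p : ZMod 5 × ZMod 5, ψ p.1 = 0 := by
    rw [Fintype.sum_prod_type]
    simp only [Finset.sum_const, ← Finset.smul_sum, sum_stdAddChar_eq_zero, smul_zero]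
  have h3 := Fintype.sum_eq_add_sum_subtype_ne (fun p : ZMod 5 × ZMod 5 => ψ p.1) 0
  rw [h2, Prod.fst_zero, AddChar.map_zero_eq_one] at h3
  rw [h1]
  linear_combination -h3

theorem charTwentyFour_of_ne_one (e : Heis) {h : SL(2, ZMod 3)} (hh : h ≠ 1) :
    charTwentyFour ⟨e, h⟩ = 0 := by
  rw [charTwentyFour, trace_inducedHom, if_neg hh]

theorem heisSL_inv (e : Heis) : (⟨e, 1⟩ : HeisSL)⁻¹ = ⟨e⁻¹, 1⟩ := by
  ext1 <;> simp

theorem isIrrChar_charTwentyFour : IsIrrChar charTwentyFour := by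
  refine isIrrChar_trace (inducedHom (Heis.symplecticAut.comp embedSL) Heis.linearChar) ?_
  change ∑ g : HeisSL, charTwentyFour g * charTwentyFour g⁻¹ = _
  rw [sum_heisSL _ (24 * 24) 1 (fun h => 0), card_heisSL]
  · norm_num
  · intro e he
    rw [heisSL_inv, charTwentyFour_of_center he, charTwentyFour_of_center (by simpa using he)]
  · intro e he
    rw [heisSL_inv, charTwentyFour_of_not_center he,
      charTwentyFour_of_not_center (by simpa using he)]
    norm_num
  · intro e h hh
    rw [charTwentyFour_of_ne_one e hh, zero_mul]

/-- The representation of degree `10`: the tensor product of the Weil representation with the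
two-dimensional representation of `SL(2,3)` given by the Hurwitz units. -/
noncomputable def tensorHom : HeisSL →* Matrix (ZMod 5 × Fin 2) (ZMod 5 × Fin 2) ℂ where
  toFun g := Matrix.kronecker (weilHom g)
    (splitHom (1 / 2) Complex.I (by norm_num) Complex.I_mul_I g.right)
  map_one' := by
    rw [map_one, SemidirectProduct.one_right, map_one]
    exact Matrix.one_kronecker_one
  map_mul' g h := by
    rw [map_mul, SemidirectProduct.mul_right, map_mul]
    exact Matrix.mul_kronecker_mul _ _ _ _

/-- The character of degree `10`. -/
noncomputable def charTen (g : HeisSL) : ℂ := (tensorHom g).trace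

theorem charTen_apply (g : HeisSL) :
    charTen g = (weilHom g).trace * (hurwitz g.right 0 : ℂ) := by
  rw [← trace_splitHom (R := ℂ) (1 / 2) Complex.I (by norm_num) Complex.I_mul_I g.right]
  exact Matrix.trace_kronecker _ _

theorem charTen_inv (g : HeisSL) : charTen g⁻¹ = conj (charTen g) := by
  rw [charTen_apply, charTen_apply, weilHom_inv, Matrix.trace_conjTranspose,
    SemidirectProduct.inv_right, hurwitz_inv_zero, map_mul, RCLike.star_def, map_intCast]

theorem charTen_of_center {e : Heis} (he : e.x = 0 ∧ e.y = 0) :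
    charTen ⟨e, 1⟩ = 10 * ψ e.z := by
  rw [charTen_apply, trace_weilHom_of_center he, hurwitz_one.1]
  push_cast
  ring

theorem charTen_one : charTen 1 = 10 := by
  have h := charTen_of_center (e := 1) ⟨rfl, rfl⟩
  rwa [Heis.one_z, AddChar.map_zero_eq_one, mul_one] at h

theorem charTen_mul_conj_of_center {e : Heis} (he : e.x = 0 ∧ e.y = 0) :
    charTen ⟨e, 1⟩ * conj (charTen ⟨e, 1⟩) = 100 := by
  rw [charTen_of_center he, map_mul, conj_stdAddChar, mul_mul_mul_comm, ← AddChar.map_add_eq_mul,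
    add_neg_cancel, AddChar.map_zero_eq_one, map_ofNat]
  norm_num

theorem charTen_of_not_center {e : Heis} (he : ¬ (e.x = 0 ∧ e.y = 0)) :
    charTen ⟨e, 1⟩ = 0 := by
  rw [charTen_apply, trace_weilHom_of_not_center he, zero_mul]

theorem charTen_mul_conj_of_ne_one (e : Heis) {h : SL(2, ZMod 3)} (hh : h ≠ 1) :
    charTen ⟨e, h⟩ * conj (charTen ⟨e, h⟩) = (hurwitz h 0 : ℂ) ^ 2 := by
  rw [charTen_apply, map_mul, mul_mul_mul_comm, trace_weilHom_mul_conj e hh, one_mul,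
    map_intCast, sq]

theorem isIrrChar_charTen : IsIrrChar charTen := by
  refine isIrrChar_trace tensorHom ?_
  change ∑ g : HeisSL, charTen g * charTen g⁻¹ = _
  have hs := congrArg (Int.cast : ℤ → ℂ) sum_hurwitz_zero_sq
  push_cast at hs
  rw [sum_heisSL _ 100 0 (fun h => (hurwitz h 0 : ℂ) ^ 2), card_heisSL, hs, hurwitz_one.1]
  · norm_num
  · intro e he
    rw [charTen_inv, charTen_mul_conj_of_center he]
  · intro e he
    rw [charTen_of_not_center he, zero_mul]
  · intro e h hh
    rw [charTen_inv, charTen_mul_conj_of_ne_one e hh]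

theorem charTen_mul_conj (g : HeisSL) :
    charTen g * conj (charTen g) = 1 + charThree g + 4 * charTwentyFour g := by
  obtain ⟨e, h⟩ := g
  rw [charThree_apply]
  by_cases hh : h = 1
  · subst hh
    by_cases he : e.x = 0 ∧ e.y = 0
    · rw [charTen_mul_conj_of_center he, charTwentyFour_of_center he, hurwitz_one.1]
      norm_num
    · rw [charTen_of_not_center he, charTwentyFour_of_not_center he, hurwitz_one.1]
      norm_num
  · rw [charTen_mul_conj_of_ne_one e hh, charTwentyFour_of_ne_one e hh]
    ring

theorem isFaithfulChar_charTen : IsFaithfulChar charTen := by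
  refine Set.eq_singleton_iff_unique_mem.2 ⟨rfl, ?_⟩
  rintro ⟨e, h⟩ (hg : charTen _ = charTen 1)
  rw [charTen_one] at hg
  by_cases hh : h = 1
  · subst hh
    by_cases he : e.x = 0 ∧ e.y = 0
    · rw [charTen_of_center he] at hg
      have hz : ψ e.z = ψ 0 := by
        rw [AddChar.map_zero_eq_one]
        linear_combination hg / 10
      have hz' := ZMod.injective_stdAddChar hz
      ext1
      · exact Heis.ext he.1 he.2 hz'
      · rfl
    · rw [charTen_of_not_center he] at hg
      norm_num at hg
  · have h2 := charTen_mul_conj_of_ne_one e hh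
    rw [hg, map_ofNat] at h2
    rcases hurwitz_zero_mem h hh with h | h | h | h <;> rw [h] at h2 <;> norm_num at h2

/-! ### Subgroups of the semidirect product -/

theorem mem_center_heisSL {g : HeisSL} :
    g ∈ Subgroup.center HeisSL ↔ g.right = 1 ∧ g.left.x = 0 ∧ g.left.y = 0 := by
  obtain ⟨e, h⟩ := g
  constructor
  · intro hg
    rw [Subgroup.mem_center_iff] at hg
    -- commuting with `E` means that `h` acts on `E` as the inner automorphism of `e⁻¹`
    have hcomm (f : Heis) : f * e = e * Heis.symplecticAut (embedSL h) f := by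
      simpa using congrArg SemidirectProduct.left (hg (SemidirectProduct.inl f))
    have hfix : h = 1 := by
      by_contra hh
      refine embedSL_trace_ne_two hh
        (trace_eq_two_of_fixed (x := 1) (y := 0) (by decide) ?_ ?_)
      · have := congrArg Heis.x (hcomm ⟨1, 0, 0⟩)
        rw [Heis.mul_x, Heis.mul_x, add_comm] at this
        exact (add_left_cancel this).symm
      · have := congrArg Heis.y (hcomm ⟨1, 0, 0⟩)
        rw [Heis.mul_y, Heis.mul_y, add_comm] at this
        exact (add_left_cancel this).symm
    subst hfix
    refine ⟨rfl, Heis.mem_center.1 (Subgroup.mem_center_iff.2 fun f => ?_)⟩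
    rw [hcomm, map_one, map_one, MulAut.one_apply]
  · rintro ⟨rfl : h = 1, hx : e.x = 0, hy : e.y = 0⟩
    rw [Subgroup.mem_center_iff]
    rintro ⟨f, k⟩
    ext <;> simp [hx, hy, add_comm]

theorem isChiefFactor_heisSL :
    IsChiefFactor (SemidirectProduct.inl : Heis →* HeisSL).range (Subgroup.center HeisSL) := by
  refine ⟨inferInstance, ?_, ?_, fun N hN hZN hNE => ?_⟩
  · rw [SemidirectProduct.range_inl_eq_ker_rightHom]
    infer_instance
  · rw [SetLike.lt_iff_le_and_exists]
    refine ⟨fun g hg => ⟨g.left, ?_⟩, SemidirectProduct.inl ⟨1, 0, 0⟩, ⟨_, rfl⟩, fun h => ?_⟩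
    · ext1
      · rfl
      · exact (mem_center_heisSL.1 hg).1.symm
    · exact absurd (mem_center_heisSL.1 h).2.1 (by decide)
  · by_cases hN' : N ≤ Subgroup.center HeisSL
    · exact .inl (le_antisymm hN' hZN)
    right
    refine le_antisymm hNE ?_
    obtain ⟨g, hg, hgZ⟩ := SetLike.not_le_iff_exists.1 hN'
    obtain ⟨e, rfl⟩ := hNE hg
    have he : ¬ (e.x = 0 ∧ e.y = 0) := fun h => hgZ (mem_center_heisSL.2 ⟨rfl, h⟩)
    rintro _ ⟨f, rfl⟩
    by_cases hf : f.x = 0 ∧ f.y = 0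
    · exact hZN (mem_center_heisSL.2 ⟨rfl, hf⟩)
    -- some conjugate of `e` agrees with `f` modulo the center
    obtain ⟨k, hk⟩ := (orbit_bijective e he).2 ⟨(f.x, f.y), fun h => hf (Prod.mk_eq_zero.1 h)⟩
    rw [Subtype.mk.injEq, Prod.mk.injEq] at hk
    have hconj : SemidirectProduct.inl (Heis.symplecticAut (embedSL k) e) ∈ N := by
      have := hN.conj_mem _ hg (SemidirectProduct.inr k)
      rwa [← map_inv, ← SemidirectProduct.inl_aut] at this
    have hZ : SemidirectProduct.inl ((Heis.symplecticAut (embedSL k) e)⁻¹ * f) ∈ N := by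
      refine hZN (mem_center_heisSL.2 ⟨rfl, ?_⟩)
      simp only [SemidirectProduct.left_inl, Heis.mul_x, Heis.mul_y, Heis.inv_x, Heis.inv_y,
        hk.1, hk.2, neg_add_cancel, and_self]
    simpa using N.mul_mem hconj hZ

theorem isSolvable_heisSL : Group.IsSolvable HeisSL := by
  have : Group.IsNilpotent Heis := Heis.isPGroup.isNilpotent
  exact Group.isSolvable_of_ker_le_range (SemidirectProduct.inl : Heis →* HeisSL)
    SemidirectProduct.rightHom SemidirectProduct.range_inl_eq_ker_rightHom.ge

theorem isComplement'_heisSL : Subgroup.IsComplement'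
    (SemidirectProduct.inl : Heis →* HeisSL).range
    (SemidirectProduct.inr : SL(2, ZMod 3) →* HeisSL).range := by
  refine Subgroup.isComplement'_of_disjoint_and_mul_eq_univ ?_ ?_
  · rw [Subgroup.disjoint_def]
    rintro _ ⟨e, rfl⟩ ⟨h, hh⟩
    have := congrArg SemidirectProduct.left hh
    rw [SemidirectProduct.left_inr, SemidirectProduct.left_inl] at this
    rw [← this, map_one]
  · refine Set.eq_univ_of_forall fun g => ⟨_, ⟨g.left, rfl⟩, _, ⟨g.right, rfl⟩, ?_⟩
    exact SemidirectProduct.inl_left_mul_inr_right g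

theorem inr_range_inf_centralizer :
    (SemidirectProduct.inr : SL(2, ZMod 3) →* HeisSL).range ⊓
      Subgroup.centralizer ((SemidirectProduct.inl : Heis →* HeisSL).range : Set HeisSL) = ⊥ := by
  rw [eq_bot_iff]
  rintro _ ⟨⟨h, rfl⟩, hc⟩
  rw [Subgroup.mem_bot]
  by_contra hne
  have hh : h ≠ 1 := fun h1 => hne (by rw [h1, map_one])
  have hfix : (⟨1, 0, 0⟩ : Heis) = Heis.symplecticAut (embedSL h) ⟨1, 0, 0⟩ := by
    have := Subgroup.mem_centralizer_iff.1 hc (SemidirectProduct.inl ⟨1, 0, 0⟩) ⟨_, rfl⟩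
    simpa using congrArg SemidirectProduct.left this
  exact embedSL_trace_ne_two hh (trace_eq_two_of_fixed (x := 1) (y := 0) (by decide)
    (congrArg Heis.x hfix).symm (congrArg Heis.y hfix).symm)

theorem mainTheorem12 :
    ∃ (G : Type) (_ : Group G) (_ : Finite G) (E H : Subgroup G) (_ : E.Normal),
      -- `G = E ⋊ H`, with `E` extra-special of order `5 ^ 3` and exponent `5`, and with
      -- `H ≅ SL(2,3)` acting faithfully on `E`
      Group.IsSolvable G ∧
      IsExtraspecial 5 E ∧ Nat.card E = 5 ^ 3 ∧ Monoid.exponent E = 5 ∧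
      Nonempty (H ≃* SL(2, ZMod 3)) ∧
      Subgroup.IsComplement' E H ∧
      H ⊓ Subgroup.centralizer (E : Set G) = ⊥ ∧
      ∃ χ α₁ α₂ : G → ℂ,
        -- the characters
        IsIrrChar χ ∧ IsFaithfulChar χ ∧ χ 1 = 10 ∧
        IsIrrChar α₁ ∧ α₁ ≠ 1 ∧ α₁ 1 = 3 ∧
        IsIrrChar α₂ ∧ α₂ ≠ 1 ∧ α₂ 1 = 24 ∧
        (∀ g : G, χ g * conj (χ g) = 1 + α₁ g + 4 * α₂ g) ∧
        -- the kernel of `α₁` is not abelian, and `E / Z(G)` is a chief factor below it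
        (¬ ∀ x ∈ charKer α₁, ∀ y ∈ charKer α₁, x * y = y * x) ∧
        IsChiefFactor E (Subgroup.center G) ∧
        (E : Set G) ⊆ charKer α₁ ∧
        -- the structure of `G / E`
        Nonempty (fittingSubgroup (G ⧸ E) ≃* QuaternionGroup 2) ∧
        Nonempty ((G ⧸ E) ≃* SL(2, ZMod 3)) := by
  let E : Subgroup HeisSL := (SemidirectProduct.inl : Heis →* HeisSL).range
  let H : Subgroup HeisSL := (SemidirectProduct.inr : SL(2, ZMod 3) →* HeisSL).range
  have hker : E = (SemidirectProduct.rightHom : HeisSL →* SL(2, ZMod 3)).ker :=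
    SemidirectProduct.range_inl_eq_ker_rightHom
  have hE : E.Normal := isChiefFactor_heisSL.2.1
  let eE : Heis ≃* E := MonoidHom.ofInjective SemidirectProduct.inl_injective
  let eH : SL(2, ZMod 3) ≃* H := MonoidHom.ofInjective SemidirectProduct.inr_injective
  let eQ : HeisSL ⧸ E ≃* SL(2, ZMod 3) := (QuotientGroup.quotientMulEquivOfEq hker).trans
    (QuotientGroup.quotientKerEquivOfSurjective _ SemidirectProduct.rightHom_surjective)
  have hEker (e : Heis) : SemidirectProduct.inl e ∈ charKer charThree := by
    change charThree _ = charThree 1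
    rw [charThree_apply, charThree_apply]
    rfl
  have h24 : charTwentyFour 1 = 24 := charTwentyFour_of_center (e := 1) ⟨rfl, rfl⟩
  have h3 : charThree 1 = 3 := by
    rw [charThree_apply, SemidirectProduct.one_right, hurwitz_one.1]
    norm_num
  refine ⟨HeisSL, inferInstance, inferInstance, E, H, hE, isSolvable_heisSL,
    Heis.isExtraspecial.of_mulEquiv eE, ?_, ?_, ⟨eH.symm⟩, isComplement'_heisSL,
    inr_range_inf_centralizer, charTen, charThree, charTwentyFour, isIrrChar_charTen,
    isFaithfulChar_charTen, charTen_one, isIrrChar_charThree, ?_, h3, isIrrChar_charTwentyFour, ?_,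
    h24, charTen_mul_conj, ?_, isChiefFactor_heisSL, ?_, ?_, ⟨eQ⟩⟩
  · rw [← Nat.card_congr eE.toEquiv, Heis.card_eq]
  · rw [← Monoid.exponent_eq_of_mulEquiv eE, Heis.exponent_eq]
  · intro h
    rw [h] at h3
    norm_num at h3
  · intro h
    rw [h] at h24
    norm_num at h24
  · intro h
    have h1 := h _ (hEker ⟨1, 0, 0⟩) _ (hEker ⟨0, 1, 0⟩)
    rw [← map_mul, ← map_mul, SemidirectProduct.inl_inj] at h1
    exact absurd (congrArg Heis.z h1) (by decide)
  · rintro _ ⟨e, rfl⟩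
    exact hEker e
  · -- the isomorphism of `G ⧸ E` with `SL(2,3)` carries Fitting subgroup to Fitting subgroup
    exact ⟨(eQ.subgroupMap _).trans ((MulEquiv.subgroupCongr
      ((map_fittingSubgroup eQ).trans fittingSubgroup_SL_two_three)).trans
      (MonoidHom.ofInjective quaternionHom_injective).symm)⟩
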